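/- An $r$-graph $H$ on a finite vertex set $V$ is a set of $r$-element subsets of $V$ (its edges). For pairwise disjoint $X_1,\dots,X_r\subseteq V$ let $E_H(X_1,\dots,X_r)$ be the set of edges of $H$ having exactly one vertex in each $X_i$, and let $d_H(X_1,\dots,X_r)=\frac{|E_H(X_1,\dots,X_r)|}{|X_1|\cdots|X_r|}$. For pairwise disjoint non-empty $V_1,\dots,V_r\subseteq V$, the tuple $(V_1,\dots,V_r)$ is $(\varepsilon,p)$-regular in $H$ if $|d_H(X_1,\dots,X_r)-d_H(V_1,\dots,V_r)|\le\varepsilon p$ for all $X_i\subseteq V_i$ with $|X_i|\ge\varepsilon|V_i|$, $i=1,\dots,r$. A partition of $V$ into $t$ non-empty parts is $(\varepsilon,p)$-regular with respect to $H$ if the sizes of its parts differ by at most $1$ and all but at most $\varepsilon\binom{t}{r}$ of the $r$-sets of its parts are $(\varepsilon,p)$-regular in $H$. Finally, $H$ is $(\eta,p,D)$-upper-uniform if $d_H(X_1,\dots,X_r)\le Dp$ for all pairwise disjoint $X_1,\dots,X_r\subseteq V$ with $|X_i|\ge\eta|V|$ for every $i$. **Lemma (multicolour weak sparse hypergraph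 regularity lemma).** Let $\varepsilon>0$ and $D>1$ be real and let $q,r,t_0\ge 1$ be integers. Then there are an integer $T_0$ and a real $\eta_0>0$, depending only on $\varepsilon,D,q,r,t_0$, such that the following holds for all integers $T\ge T_0$, all $0<\eta\le\eta_0$ and all $p\in[0,1]$. If $H_1,\dots,H_q$ are $(\eta,p,D)$-upper-uniform $r$-graphs on the same finite vertex set $V$ with $|V|\ge t_0$, then there is a partition of $V$ into $t$ parts, for some $t_0\le t\le T$, which is $(\varepsilon,p)$-regular with respect to $H_j$ for every $j=1,\dots,q$. -/

import Mathlib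

/-- An `r`-graph on the vertex set `V`: a set of edges, each of them a set of exactly `r`
vertices. -/
structure RGraph (V : Type*) (r : ℕ) where
  edges : Finset (Finset V)
  card_eq : ∀ e ∈ edges, e.card = r

namespace RGraph

variable {V : Type*} [DecidableEq V] {r : ℕ} {ι : Type*} [Fintype ι]

/-- `E(X)`: the edges having exactly one vertex in each `X i`. -/
def crossingEdges (H : RGraph V r) (X : ι → Finset V) : Finset (Finset V) :=
  H.edges.filter fun e => ∀ i, (e ∩ X i).card = 1

/-- The density `d(X) = |E(X)| / ∏ |X i|`. -/
noncomputable def density (H : RGraph V r) (X : ι → Finset V) : ℝ :=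
  ((H.crossingEdges X).card : ℝ) / ∏ i, ((X i).card : ℝ)

/-- The `r`-partite `r`-graph induced by `H` on the parts `W i` is `(ε, p)`-regular. -/
def IsRegularTuple (H : RGraph V r) (ε p : ℝ) (W : ι → Finset V) : Prop :=
  ∀ X : ι → Finset V, (∀ i, X i ⊆ W i) → (∀ i, ε * ((W i).card : ℝ) ≤ ((X i).card : ℝ)) →
    |H.density X - H.density W| ≤ ε * p

open Classical in
/-- The `r`-sets of parts of `P` that do not induce an `(ε, p)`-regular `r`-partite `r`-graph.
An `r`-set `𝒜` of parts is viewed as the family of parts indexed by `𝒜` itself. -/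
noncomputable def irregularSets [Fintype V] (H : RGraph V r) (ε p : ℝ)
    (P : Finpartition (Finset.univ : Finset V)) : Finset (Finset (Finset V)) :=
  (P.parts.powersetCard r).filter fun 𝒜 =>
    ¬ H.IsRegularTuple ε p (fun A : 𝒜 => (A : Finset V))

/-- `P` is an `(ε, p)`-regular partition for `H`: it is an equipartition, and all but at most
`ε * (t choose r)` of the `r`-sets of its `t` parts are `(ε, p)`-regular. -/
def IsRegularPartition [Fintype V] (H : RGraph V r) (ε p : ℝ)
    (P : Finpartition (Finset.univ : Finset V)) : Prop :=
  P.IsEquipartition ∧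
    ((H.irregularSets ε p P).card : ℝ) ≤ ε * (P.parts.card.choose r : ℝ)

/-- `H` is `(η, p, D)`-upper-uniform. -/
def IsUpperUniform [Fintype V] (H : RGraph V r) (η p D : ℝ) : Prop :=
  ∀ X : Fin r → Finset V, (∀ i j, i ≠ j → Disjoint (X i) (X j)) →
    (∀ i, η * (Fintype.card V : ℝ) ≤ ((X i).card : ℝ)) → H.density X ≤ D * p

end RGraph

open Finset

/-! ### Sums and densities of functions on boxes -/

section Boxes

variable {V : Type*} {r : ℕ}

/-! For `p > 0`, replace each `H j` by the function `edgeFun`, the edge indicator divided by `p`, on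
ordered `r`-tuples of vertices. Its box averages are densities divided by `p`, so regularity at
scale `ε * p` becomes regularity at scale `ε`. Upper-uniformity says that averages over large
disjoint boxes are at most `D`, although the function itself may be as large as `1 / p`. It remains
to regularise several non-negative functions with this bound (`exists_isEquipartition_regular`).

The proof is an energy increment. The mean-square energy `boxEnergy` is at most `D ^ 2 * n ^ r`,
where `n` is the number of vertices, as long as the parts are large. If `P` is irregular for some
function, it is not refined exactly: an equipartition `Q` into many parts is chosen such that every
part of `P` and every side of a witness of irregularity is a union of parts of `Q`, up to a
`δ`-fraction (`exists_isEquipartition_approx`). By `abs_boxDensity_sub_le` such errors hardly change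
densities, so no energy drops much, while Cauchy-Schwarz with defect (`weighted_sq_sum_ge`) raises
that of the irregular function by a fixed multiple of `n ^ r` (`exists_energy_increment`). With `δ`
small in terms of the number of functions, the sum of all energies rises at each step, so the
process stops after boundedly many.

Vertex sets too small for this are partitioned into singletons; for `p = 0`, upper-uniformity makes
all relevant densities vanish. -/

/-- The sum of `g` over the box `∏ X i`. -/
def boxSum (g : (Fin r → V) → ℝ) (X : Fin r → Finset V) : ℝ :=
  ∑ x ∈ Fintype.piFinset X, g x

/-- The number of points of the box `∏ X i`. -/
def boxCard (X : Fin r → Finset V) : ℝ := ∏ i, (#(X i) : ℝ)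

/-- The average of `g` over the box `∏ X i`. -/
noncomputable def boxDensity (g : (Fin r → V) → ℝ) (X : Fin r → Finset V) : ℝ :=
  boxSum g X / boxCard X

/-- The averages of `g` over sub-boxes of `A` that are large in each direction are `ε`-close to
the average over `A`. -/
def IsRegularBox (g : (Fin r → V) → ℝ) (ε : ℝ) (A : Fin r → Finset V) : Prop :=
  ∀ X : Fin r → Finset V, (∀ i, X i ⊆ A i) → (∀ i, ε * (#(A i) : ℝ) ≤ #(X i)) →
    |boxDensity g X - boxDensity g A| ≤ ε

/-- The averages of `g` over boxes with disjoint sides of size at least `s` are at most `D`. -/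
def HasBoxBound (g : (Fin r → V) → ℝ) (s D : ℝ) : Prop :=
  ∀ X : Fin r → Finset V, (∀ i j, i ≠ j → Disjoint (X i) (X j)) →
    (∀ i, s ≤ (#(X i) : ℝ)) → boxDensity g X ≤ D

theorem boxCard_nonneg (X : Fin r → Finset V) : 0 ≤ boxCard X :=
  prod_nonneg fun _ _ => Nat.cast_nonneg _

theorem boxCard_pos {X : Fin r → Finset V} (h : ∀ i, (X i).Nonempty) : 0 < boxCard X :=
  prod_pos fun i _ => Nat.cast_pos.2 (h i).card_pos

theorem boxSum_one (X : Fin r → Finset V) : boxSum (fun _ => 1) X = boxCard X := by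
  simp [boxSum, boxCard, Fintype.card_piFinset]

variable {g : (Fin r → V) → ℝ}

theorem boxSum_nonneg (hg : ∀ x, 0 ≤ g x) (X : Fin r → Finset V) : 0 ≤ boxSum g X :=
  sum_nonneg fun x _ => hg x

theorem boxDensity_nonneg (hg : ∀ x, 0 ≤ g x) (X : Fin r → Finset V) : 0 ≤ boxDensity g X :=
  div_nonneg (boxSum_nonneg hg X) (boxCard_nonneg X)

theorem boxSum_mono (hg : ∀ x, 0 ≤ g x) {X Y : Fin r → Finset V} (h : ∀ i, X i ⊆ Y i) :
    boxSum g X ≤ boxSum g Y :=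
  sum_le_sum_of_subset_of_nonneg (Fintype.piFinset_subset _ _ h) fun x _ _ => hg x

theorem boxCard_mul_boxDensity {X : Fin r → Finset V} (h : ∀ i, (X i).Nonempty) :
    boxCard X * boxDensity g X = boxSum g X :=
  mul_div_cancel₀ _ (boxCard_pos h).ne'

/-- A union bound: a point of the first box outside the second has some coordinate in `X i \ X' i`.
-/
theorem boxSum_le_add_sum_update [DecidableEq V] (hg : ∀ x, 0 ≤ g x)
    (X X' : Fin r → Finset V) :
    boxSum g X ≤ boxSum g X' + ∑ i, boxSum g (Function.update X i (X i \ X' i)) := by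
  have hsub : Fintype.piFinset X ⊆ Fintype.piFinset X' ∪
      univ.biUnion fun i => Fintype.piFinset (Function.update X i (X i \ X' i)) := by
    intro x hx
    rw [Fintype.mem_piFinset] at hx
    by_cases h : ∀ i, x i ∈ X' i
    · exact mem_union_left _ (Fintype.mem_piFinset.2 h)
    · push Not at h
      obtain ⟨i, hi⟩ := h
      refine mem_union_right _ (mem_biUnion.2 ⟨i, mem_univ _, Fintype.mem_piFinset.2 fun j => ?_⟩)
      rcases eq_or_ne j i with rfl | hj
      · simpa using ⟨hx j, hi⟩
      · simpa [hj] using hx j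
  have hbi : ∀ s : Finset (Fin r), ∑ x ∈ s.biUnion
        (fun i => Fintype.piFinset (Function.update X i (X i \ X' i))), g x ≤
      ∑ i ∈ s, boxSum g (Function.update X i (X i \ X' i)) := by
    intro s
    induction s using Finset.induction_on with
    | empty => simp
    | insert a s ha ih =>
      rw [biUnion_insert, sum_insert ha]
      refine le_trans ?_ (add_le_add le_rfl ih)
      rw [boxSum, ← sum_union_inter]
      exact le_add_of_nonneg_right (sum_nonneg fun x _ => hg x)
  calc boxSum g X ≤ _ := sum_le_sum_of_subset_of_nonneg hsub fun x _ _ => hg x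
    _ ≤ ∑ x ∈ Fintype.piFinset X', g x + ∑ x ∈ univ.biUnion
        (fun i => Fintype.piFinset (Function.update X i (X i \ X' i))), g x := by
      rw [← sum_union_inter]
      exact le_add_of_nonneg_right (sum_nonneg fun x _ => hg x)
    _ ≤ _ := add_le_add le_rfl (hbi univ)

theorem boxCard_update (X : Fin r → Finset V) (i : Fin r) (Y : Finset V) :
    boxCard (Function.update X i Y) * #(X i) = #Y * boxCard X := by
  unfold boxCard
  rw [Fintype.prod_eq_mul_prod_compl i, Fintype.prod_eq_mul_prod_compl i (fun j => (#(X j) : ℝ)),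
    prod_congr rfl (g := fun j => (#(X j) : ℝ))]
  · simp; ring
  · intro j hj
    rw [Function.update_of_ne (by simpa using hj)]

/-- A weighted Cauchy-Schwarz inequality with a gain from a subset on which the average of `d`
differs from the global one. -/
theorem weighted_sq_sum_ge {κ : Type*} {s s' : Finset κ} (hs : s' ⊆ s) {w d : κ → ℝ}
    (hw : ∀ k, 0 ≤ w k) {W W' a b : ℝ} (hW : ∑ k ∈ s, w k = W) (hW' : ∑ k ∈ s', w k = W')
    (ha : ∑ k ∈ s, w k * d k = W * a) (hb : ∑ k ∈ s', w k * d k = W' * b) :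
    W * a ^ 2 + W' * (b - a) ^ 2 ≤ ∑ k ∈ s, w k * d k ^ 2 := by
  -- The variance about `a` over `s` dominates its restriction to `s'`, which is the variance about
  -- `b` there plus `W' * (b - a) ^ 2`.
  have h1 : ∑ k ∈ s, w k * (d k - a) ^ 2 = ∑ k ∈ s, w k * d k ^ 2 - W * a ^ 2 := by
    have : ∀ k, w k * (d k - a) ^ 2 = w k * d k ^ 2 - 2 * a * (w k * d k) + a ^ 2 * w k :=
      fun k => by ring
    simp_rw [this, sum_add_distrib, sum_sub_distrib, ← mul_sum, ha, hW]
    ring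
  have h2 : ∑ k ∈ s', w k * (d k - b) ^ 2 = ∑ k ∈ s', w k * (d k - a) ^ 2 - W' * (b - a) ^ 2 := by
    have : ∀ k, w k * (d k - b) ^ 2 =
        w k * (d k - a) ^ 2 - 2 * (b - a) * (w k * d k) + (b ^ 2 - a ^ 2) * w k :=
      fun k => by ring
    simp_rw [this, sum_add_distrib, sum_sub_distrib, ← mul_sum, hb, hW']
    ring
  have h3 : ∑ k ∈ s', w k * (d k - a) ^ 2 ≤ ∑ k ∈ s, w k * (d k - a) ^ 2 :=
    sum_le_sum_of_subset_of_nonneg hs fun k _ _ => mul_nonneg (hw k) (sq_nonneg _)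
  have h4 : 0 ≤ ∑ k ∈ s', w k * (d k - b) ^ 2 :=
    sum_nonneg fun k _ => mul_nonneg (hw k) (sq_nonneg _)
  linarith

/-- Removing a `δ`-fraction of each side of a box barely changes its number of points. -/
theorem boxCard_ge_of_card_sdiff_le [DecidableEq V] {δ : ℝ} (hδ : δ ≤ 1)
    {X X' : Fin r → Finset V} (hX : ∀ i, X' i ⊆ X i)
    (h : ∀ i, (#(X i \ X' i) : ℝ) ≤ δ * #(X i)) :
    (1 - r * δ) * boxCard X ≤ boxCard X' := by
  have h1 : (1 - δ) ^ r * boxCard X ≤ boxCard X' := by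
    have : (1 - δ) ^ r * boxCard X = ∏ i, ((1 - δ) * (#(X i) : ℝ)) := by
      simp [prod_mul_distrib, boxCard]
    rw [this]
    refine prod_le_prod (fun i _ => mul_nonneg (by linarith) (Nat.cast_nonneg _)) fun i _ => ?_
    have := h i
    rw [cast_card_sdiff (hX i)] at this
    linarith
  have h2 := one_add_mul_le_pow (a := -δ) (by linarith) r
  refine le_trans (mul_le_mul_of_nonneg_right ?_ (boxCard_nonneg X)) h1
  calc 1 - r * δ = 1 + r * -δ := by ring
    _ ≤ (1 + -δ) ^ r := h2
    _ = _ := by rw [← sub_eq_add_neg]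

/-- Removing a `δ`-fraction of each side of a box barely changes the density, if the densities of
large boxes are bounded. -/
theorem abs_boxDensity_sub_le [DecidableEq V] (hg : ∀ x, 0 ≤ g x) {s D δ : ℝ} (hD : 0 ≤ D)
    (hb : HasBoxBound g s D) (hδ : δ ≤ 1 / 2) {X X' : Fin r → Finset V}
    (hdisj : ∀ i j, i ≠ j → Disjoint (X i) (X j)) (hX : ∀ i, X' i ⊆ X i)
    (h : ∀ i, (#(X i \ X' i) : ℝ) ≤ δ * #(X i)) (hs : ∀ i, s ≤ δ * #(X i))
    (h1 : ∀ i, 1 ≤ δ * #(X i)) :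
    |boxDensity g X - boxDensity g X'| ≤ 3 * r * D * δ := by
  have hXpos : ∀ i, 0 < (#(X i) : ℝ) := fun i => by
    refine lt_of_le_of_ne (Nat.cast_nonneg _) fun h0 => ?_
    have := h1 i
    rw [← h0] at this
    linarith
  have hδX : ∀ i, δ * #(X i) ≤ 1 / 2 * #(X i) := fun i =>
    mul_le_mul_of_nonneg_right hδ (hXpos i).le
  have hX'card : ∀ i, (1 / 2 : ℝ) * #(X i) ≤ #(X' i) := fun i => by
    have := h i
    rw [cast_card_sdiff (hX i)] at this
    linarith [hδX i]
  have hXne : ∀ i, (X i).Nonempty := fun i => card_pos.1 (Nat.cast_pos.1 (hXpos i))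
  have hX'ne : ∀ i, (X' i).Nonempty := fun i =>
    card_pos.1 (Nat.cast_pos.1 (lt_of_lt_of_le (mul_pos one_half_pos (hXpos i)) (hX'card i)))
  have hX'D : boxDensity g X' ≤ D := hb X' (fun i j hij => (hdisj i j hij).mono (hX i) (hX j))
    fun i => (hs i).trans ((hδX i).trans (hX'card i))
  have hupd : ∀ i, boxSum g (Function.update X i (X i \ X' i)) ≤ D * (2 * δ * boxCard X) := by
    intro i
    -- The removed slice may be too small for `HasBoxBound`, so it is enlarged to `⌈δ * #(X i)⌉₊`
    -- points. As `1 ≤ δ * #(X i)`, rounding up costs at most a factor 2.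
    obtain ⟨Y, hY1, hY2, hYc⟩ := exists_subsuperset_card_eq (s := X i \ X' i) (t := X i)
      (n := ⌈δ * #(X i)⌉₊) sdiff_subset (Nat.cast_le.1 ((h i).trans (Nat.le_ceil _)))
      (Nat.ceil_le.2 (by linarith [hδX i, hXpos i]))
    have hYle : (#Y : ℝ) ≤ 2 * δ * #(X i) := by
      rw [hYc]
      linarith [Nat.ceil_lt_add_one (a := δ * #(X i)) (by linarith [h1 i]), h1 i]
    have hYge : δ * #(X i) ≤ #Y := by rw [hYc]; exact Nat.le_ceil _
    have hsubY : ∀ j, Function.update X i Y j ⊆ X j := fun j => by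
      rcases eq_or_ne j i with rfl | hj
      · simpa using hY2
      · simp [hj]
    have hne : ∀ j, (Function.update X i Y j).Nonempty := fun j => by
      rcases eq_or_ne j i with rfl | hj
      · simpa using card_pos.1 (Nat.cast_pos.1 (lt_of_lt_of_le one_pos ((h1 j).trans hYge)))
      · simpa [hj] using hXne j
    have hd := hb (Function.update X i Y)
      (fun a b hab => (hdisj a b hab).mono (hsubY a) (hsubY b)) fun j => by
        rcases eq_or_ne j i with rfl | hj
        · simpa using (hs j).trans hYge
        · simpa [hj] using (hs j).trans (by linarith [hδX j, hXpos j])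
    have hle : boxCard (Function.update X i Y) ≤ 2 * δ * boxCard X := by
      refine le_of_mul_le_mul_right ?_ (hXpos i)
      rw [boxCard_update]
      calc _ ≤ 2 * δ * #(X i) * boxCard X := mul_le_mul_of_nonneg_right hYle (boxCard_nonneg X)
        _ = _ := by ring
    calc boxSum g (Function.update X i (X i \ X' i)) ≤ boxSum g (Function.update X i Y) := by
          refine boxSum_mono hg fun j => ?_
          rcases eq_or_ne j i with rfl | hj
          · simpa using hY1
          · simp [hj]
      _ = boxCard (Function.update X i Y) * boxDensity g (Function.update X i Y) :=
          (boxCard_mul_boxDensity hne).symm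
      _ ≤ boxCard (Function.update X i Y) * D :=
          mul_le_mul_of_nonneg_left hd (boxCard_nonneg _)
      _ ≤ 2 * δ * boxCard X * D := mul_le_mul_of_nonneg_right hle hD
      _ = _ := by ring
  have hW := boxCard_pos hXne
  have hW' := boxCard_pos hX'ne
  have hcard := boxCard_ge_of_card_sdiff_le (by linarith) hX h
  have hsum : boxSum g X ≤ boxSum g X' + r * (D * (2 * δ * boxCard X)) := by
    refine (boxSum_le_add_sum_update hg X X').trans (add_le_add le_rfl ?_)
    refine (sum_le_sum fun i _ => hupd i).trans_eq ?_
    simp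
  have hmono := boxSum_mono hg hX
  rw [← boxCard_mul_boxDensity hXne, ← boxCard_mul_boxDensity hX'ne] at hsum hmono
  have hd0 := boxDensity_nonneg hg X'
  have hcardle : boxCard X' ≤ boxCard X := prod_le_prod (fun _ _ => Nat.cast_nonneg _)
    fun i _ => Nat.cast_le.2 (card_le_card (hX i))
  -- The sign of `δ` can only be read off from `h1` at some index, so `r = 0` is treated apart.
  rcases Nat.eq_zero_or_pos r with rfl | hr
  · have : X = X' := Subsingleton.elim _ _
    simp [this]
  have hδ0 : 0 ≤ δ := by
    have := (h1 ⟨0, hr⟩)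
    by_contra hneg
    push Not at hneg
    linarith [mul_neg_of_neg_of_pos hneg (hXpos ⟨0, hr⟩)]
  have hrDδ : 0 ≤ r * D * δ := by positivity
  rw [abs_le]
  constructor
  · refine le_of_mul_le_mul_left ?_ hW
    have h5 := mul_le_mul_of_nonneg_right hcard hd0
    have h6 : r * δ * boxCard X * boxDensity g X' ≤ r * δ * boxCard X * D :=
      mul_le_mul_of_nonneg_left hX'D (by positivity)
    have h7 : 0 ≤ boxCard X * (r * D * δ) := by positivity
    linarith
  · refine le_of_mul_le_mul_left ?_ hW
    have h5 := mul_le_mul_of_nonneg_right hcardle hd0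
    have h7 : 0 ≤ boxCard X * (r * D * δ) := by positivity
    linarith

end Boxes

/-! ### Partitions and energy -/

section Partitions

variable {V : Type*} [Fintype V] [DecidableEq V] {r : ℕ}

/-- The union of the parts of `Q` that are contained in `t`. -/
def Finpartition.innerUnion (Q : Finpartition (univ : Finset V)) (t : Finset V) : Finset V :=
  {u ∈ Q.parts | u ⊆ t}.biUnion id

/-- The tuples of pairwise distinct parts of `P`. -/
def Finpartition.tuples (P : Finpartition (univ : Finset V)) (r : ℕ) :
    Finset (Fin r → Finset V) :=
  {A ∈ Fintype.piFinset fun _ => P.parts | Function.Injective A}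

/-- The tuples of parts of `Q` that refine the tuple `A`. -/
def Finpartition.tuplesIn (Q : Finpartition (univ : Finset V)) (A : Fin r → Finset V) :
    Finset (Fin r → Finset V) :=
  Fintype.piFinset fun i => {u ∈ Q.parts | u ⊆ A i}

/-- The energy of `g` with respect to the partition `P`. -/
noncomputable def boxEnergy (g : (Fin r → V) → ℝ) (P : Finpartition (univ : Finset V)) : ℝ :=
  ∑ A ∈ P.tuples r, boxCard A * boxDensity g A ^ 2

namespace Finpartition

variable {P Q : Finpartition (univ : Finset V)}

theorem mem_tuples {A : Fin r → Finset V} :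
    A ∈ P.tuples r ↔ (∀ i, A i ∈ P.parts) ∧ Function.Injective A := by
  simp [tuples]

theorem mem_tuplesIn {A B : Fin r → Finset V} :
    B ∈ Q.tuplesIn A ↔ ∀ i, B i ∈ Q.parts ∧ B i ⊆ A i := by
  simp [tuplesIn]

theorem disjoint_of_mem_tuples {A : Fin r → Finset V} (hA : A ∈ P.tuples r) (i j : Fin r)
    (hij : i ≠ j) : Disjoint (A i) (A j) :=
  P.disjoint ((mem_tuples.1 hA).1 i) ((mem_tuples.1 hA).1 j) fun h =>
    hij ((mem_tuples.1 hA).2 h)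

theorem innerUnion_subset (t : Finset V) : Q.innerUnion t ⊆ t := by
  intro x hx
  simp only [innerUnion, mem_biUnion, mem_filter, id] at hx
  obtain ⟨u, ⟨-, hu⟩, hxu⟩ := hx
  exact hu hxu

theorem sum_tuplesIn_boxSum (g : (Fin r → V) → ℝ) (A : Fin r → Finset V) :
    ∑ B ∈ Q.tuplesIn A, boxSum g B = boxSum g fun i => Q.innerUnion (A i) := by
  unfold boxSum
  rw [← sum_biUnion]
  · refine sum_congr ?_ fun _ _ => rfl
    ext x
    simp only [mem_biUnion, mem_tuplesIn, Fintype.mem_piFinset, innerUnion, mem_filter, id]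
    constructor
    · rintro ⟨B, hB, hx⟩ i
      exact ⟨B i, hB i, hx i⟩
    · intro h
      choose B hB hx using h
      exact ⟨B, hB, hx⟩
  · intro B hB B' hB' hne
    rw [Function.onFun, disjoint_left]
    intro x hx hx'
    rw [Fintype.mem_piFinset] at hx hx'
    exact hne (funext fun i => Q.eq_of_mem_parts (mem_tuplesIn.1 hB i).1
      (mem_tuplesIn.1 hB' i).1 (hx i) (hx' i))

theorem sum_tuplesIn_boxCard (A : Fin r → Finset V) :
    ∑ B ∈ Q.tuplesIn A, boxCard B = boxCard fun i => Q.innerUnion (A i) := by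
  simp_rw [← boxSum_one, sum_tuplesIn_boxSum]

theorem nonempty_of_mem_tuplesIn {A B : Fin r → Finset V} (hB : B ∈ Q.tuplesIn A) (i : Fin r) :
    (B i).Nonempty :=
  Q.nonempty_of_mem_parts (mem_tuplesIn.1 hB i).1

/-- Inside a fixed tuple of sets, the energy is at least that of the trivial partition, with a gain
from any sub-box of different density. -/
theorem boxEnergy_in_ge (g : (Fin r → V) → ℝ) {A X : Fin r → Finset V} (hX : ∀ i, X i ⊆ A i)
    (hA : ∀ i, (Q.innerUnion (A i)).Nonempty) (hX' : ∀ i, (Q.innerUnion (X i)).Nonempty) :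
    boxCard (fun i => Q.innerUnion (A i)) * boxDensity g (fun i => Q.innerUnion (A i)) ^ 2 +
      boxCard (fun i => Q.innerUnion (X i)) *
        (boxDensity g (fun i => Q.innerUnion (X i)) -
          boxDensity g (fun i => Q.innerUnion (A i))) ^ 2 ≤
      ∑ B ∈ Q.tuplesIn A, boxCard B * boxDensity g B ^ 2 := by
  have hd : ∀ Y : Fin r → Finset V, (∀ i, (Q.innerUnion (Y i)).Nonempty) →
      ∑ B ∈ Q.tuplesIn Y, boxCard B * boxDensity g B =
        boxCard (fun i => Q.innerUnion (Y i)) * boxDensity g fun i => Q.innerUnion (Y i) := by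
    intro Y hY
    rw [boxCard_mul_boxDensity hY, ← sum_tuplesIn_boxSum]
    exact sum_congr rfl fun B hB => boxCard_mul_boxDensity (nonempty_of_mem_tuplesIn hB)
  refine weighted_sq_sum_ge (s' := Q.tuplesIn X) ?_ (fun B => boxCard_nonneg B)
    (sum_tuplesIn_boxCard A) (sum_tuplesIn_boxCard X) (hd A hA) (hd X hX')
  intro B hB
  rw [mem_tuplesIn] at hB ⊢
  exact fun i => ⟨(hB i).1, (hB i).2.trans (hX i)⟩

/-- `Q` need not refine `P`. Distinct tuples of `P` contain disjoint families of tuples of `Q`, and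
the tuples of `Q` lying in no tuple of `P` contribute non-negative terms. -/
theorem sum_tuplesIn_le_boxEnergy (g : (Fin r → V) → ℝ) :
    ∑ A ∈ P.tuples r, ∑ B ∈ Q.tuplesIn A, boxCard B * boxDensity g B ^ 2 ≤ boxEnergy g Q := by
  rw [← sum_biUnion]
  · refine sum_le_sum_of_subset_of_nonneg ?_ fun B _ _ =>
      mul_nonneg (boxCard_nonneg B) (sq_nonneg _)
    intro B hB
    simp only [mem_biUnion] at hB
    obtain ⟨A, hA, hB⟩ := hB
    refine mem_tuples.2 ⟨fun i => (mem_tuplesIn.1 hB i).1, fun i j hij => ?_⟩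
    by_contra hne
    obtain ⟨x, hx⟩ := nonempty_of_mem_tuplesIn hB i
    exact disjoint_left.1 (disjoint_of_mem_tuples hA i j hne) ((mem_tuplesIn.1 hB i).2 hx)
      ((mem_tuplesIn.1 hB j).2 (hij ▸ hx))
  · intro A hA A' hA' hne
    rw [Function.onFun, disjoint_left]
    intro B hB hB'
    refine hne (funext fun i => ?_)
    obtain ⟨x, hx⟩ := nonempty_of_mem_tuplesIn hB i
    exact P.eq_of_mem_parts ((mem_tuples.1 hA).1 i) ((mem_tuples.1 hA').1 i)
      ((mem_tuplesIn.1 hB i).2 hx) ((mem_tuplesIn.1 hB' i).2 hx)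

theorem sum_boxCard_tuples_le : ∑ A ∈ P.tuples r, boxCard A ≤ (Fintype.card V : ℝ) ^ r := by
  calc ∑ A ∈ P.tuples r, boxCard A
      ≤ ∑ A ∈ Fintype.piFinset fun _ : Fin r => P.parts, boxCard A :=
        sum_le_sum_of_subset_of_nonneg (filter_subset _ _) fun A _ _ => boxCard_nonneg A
    _ = ∏ _i : Fin r, ∑ u ∈ P.parts, (#u : ℝ) := by
        simp_rw [boxCard]
        exact (prod_univ_sum (fun _ => P.parts) fun _ u => (#u : ℝ)).symm
    _ = (Fintype.card V : ℝ) ^ r := by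
        have := P.sum_card_parts
        rw [← Nat.cast_sum, this]
        simp

theorem boxEnergy_le {g : (Fin r → V) → ℝ} (hg : ∀ x, 0 ≤ g x) {s D : ℝ}
    (hb : HasBoxBound g s D) (hP : ∀ u ∈ P.parts, s ≤ (#u : ℝ)) :
    boxEnergy g P ≤ D ^ 2 * (Fintype.card V : ℝ) ^ r := by
  calc boxEnergy g P ≤ ∑ A ∈ P.tuples r, boxCard A * D ^ 2 := by
        refine sum_le_sum fun A hA => mul_le_mul_of_nonneg_left ?_ (boxCard_nonneg A)
        exact pow_le_pow_left₀ (boxDensity_nonneg hg A)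
          (hb A (disjoint_of_mem_tuples hA) fun i => hP _ ((mem_tuples.1 hA).1 i)) 2
    _ = D ^ 2 * ∑ A ∈ P.tuples r, boxCard A := by rw [← sum_mul, mul_comm]
    _ ≤ _ := mul_le_mul_of_nonneg_left sum_boxCard_tuples_le (sq_nonneg D)

/-- Every finite family of sets is approximated by an equipartition with a given number of parts. -/
theorem exists_isEquipartition_approx (F : Finset (Finset V)) {M : ℕ} (hM : M ≠ 0)
    (hMn : M ≤ Fintype.card V) :
    ∃ Q : Finpartition (univ : Finset V), Q.IsEquipartition ∧ #Q.parts = M ∧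
      ∀ t ∈ F, #(t \ Q.innerUnion t) ≤ 2 ^ #F * (Fintype.card V / M) := by
  set n := Fintype.card V
  -- The cell sizes of an equipartition into `M` cells: `n % M` of them have one extra element.
  have hn : (M - n % M) * (n / M) + n % M * (n / M + 1) = #(univ : Finset V) := by
    have hlt := Nat.mod_lt n (Nat.pos_of_ne_zero hM)
    have := Nat.mod_add_div n M
    rw [card_univ, mul_add, ← add_assoc, ← add_mul, Nat.sub_add_cancel hlt.le, mul_one]
    omega
  have hm : n / M ≠ 0 := (Nat.div_pos hMn (Nat.pos_of_ne_zero hM)).ne'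
  -- Each member of `F` is a union of atoms. Cutting the atoms into cells leaves at most `n / M`
  -- points of each uncovered, and there are at most `2 ^ #F` atoms.
  set R := atomise (univ : Finset V) F
  refine ⟨R.equitabilise hn, equitabilise_isEquipartition, ?_, fun t ht => ?_⟩
  · rw [R.card_parts_equitabilise hn hm]
    exact Nat.sub_add_cancel (Nat.mod_lt n (Nat.pos_of_ne_zero hM)).le
  · have hsub : t \ (R.equitabilise hn).innerUnion t ⊆
        {u ∈ R.parts | u ⊆ t}.biUnion fun a => a \ (R.equitabilise hn).innerUnion a := by
      intro x hx
      rw [mem_sdiff] at hx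
      have hxt := hx.1
      rw [← biUnion_filter_atomise ht (subset_univ t)] at hxt
      simp only [mem_biUnion, mem_filter, id] at hxt
      obtain ⟨a, ⟨ha, hat, -⟩, hxa⟩ := hxt
      refine mem_biUnion.2 ⟨a, mem_filter.2 ⟨ha, hat⟩, mem_sdiff.2 ⟨hxa, fun h => hx.2 ?_⟩⟩
      simp only [innerUnion, mem_biUnion, mem_filter, id] at h ⊢
      obtain ⟨u, ⟨hu, hua⟩, hxu⟩ := h
      exact ⟨u, ⟨hu, hua.trans hat⟩, hxu⟩
    refine (card_le_card hsub).trans ((card_biUnion_le_card_mul _ _ (n / M) fun a ha => ?_).trans ?_)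
    · exact R.card_parts_equitabilise_subset_le hn (mem_filter.1 ha).1
    · exact Nat.mul_le_mul_right _ ((card_le_card (filter_subset _ _)).trans card_atomise_le)

/-- Rounding `n / k` down loses at most a factor 2 because the quotient is at least 1. -/
theorem IsEquipartition.card_div_le (hP : P.IsEquipartition) (hk : #P.parts ≤ Fintype.card V)
    {u : Finset V} (hu : u ∈ P.parts) :
    (Fintype.card V : ℝ) / (2 * #P.parts) ≤ #u := by
  have h := hP.average_le_card_part hu
  rw [card_univ] at h
  have hk0 : 0 < #P.parts := card_pos.2 ⟨u, hu⟩
  have h1 : 1 ≤ Fintype.card V / #P.parts := Nat.div_pos hk hk0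
  have h2 := Nat.lt_div_mul_add (a := Fintype.card V) hk0
  have h3 : Fintype.card V ≤ 2 * #P.parts * (Fintype.card V / #P.parts) := by
    nlinarith
  have h4 : Fintype.card V ≤ 2 * #P.parts * #u := h3.trans (Nat.mul_le_mul_left _ h)
  rw [div_le_iff₀ (by positivity)]
  have : (Fintype.card V : ℝ) ≤ 2 * #P.parts * #u := by exact_mod_cast h4
  linarith

end Finpartition

end Partitions

/-! ### The energy increment -/

section Increment

variable {V : Type*} [Fintype V] [DecidableEq V] {r : ℕ}

namespace Finpartition

variable {P Q : Finpartition (univ : Finset V)}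

/-- The sides of the box `X` are, up to a `δ`-fraction, unions of parts of `Q`, and the
`δ`-fractions of these sides have at least `s` elements and are non-empty. -/
def Approximates (Q : Finpartition (univ : Finset V)) (δ s : ℝ) (X : Fin r → Finset V) : Prop :=
  ∀ i, (#(X i \ Q.innerUnion (X i)) : ℝ) ≤ δ * #(X i) ∧ s ≤ δ * #(X i) ∧ 1 ≤ δ * #(X i)

variable {δ s D : ℝ} {X A : Fin r → Finset V} {g : (Fin r → V) → ℝ}

theorem Approximates.half_card_le (h : Q.Approximates δ s X) (hδ : δ ≤ 1 / 2) (i : Fin r) :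
    (1 / 2 : ℝ) * #(X i) ≤ #(Q.innerUnion (X i)) := by
  have h1 := (h i).1
  rw [cast_card_sdiff (innerUnion_subset _)] at h1
  linarith [mul_le_mul_of_nonneg_right hδ (Nat.cast_nonneg (α := ℝ) #(X i))]

theorem Approximates.le_half_card (h : Q.Approximates δ s X) (hδ : δ ≤ 1 / 2) (i : Fin r) :
    s ≤ (1 / 2 : ℝ) * #(X i) :=
  (h i).2.1.trans (mul_le_mul_of_nonneg_right hδ (Nat.cast_nonneg (α := ℝ) #(X i)))

theorem Approximates.nonempty (h : Q.Approximates δ s X) (hδ : δ ≤ 1 / 2) (i : Fin r) :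
    (Q.innerUnion (X i)).Nonempty := by
  rw [← card_pos, ← Nat.cast_pos (α := ℝ)]
  linarith [h.half_card_le hδ i, (h i).2.2,
    mul_le_mul_of_nonneg_right hδ (Nat.cast_nonneg (α := ℝ) #(X i))]

theorem Approximates.abs_boxDensity_sub_le (h : Q.Approximates δ s X) (hδ : δ ≤ 1 / 2)
    (hg : ∀ x, 0 ≤ g x) (hD : 0 ≤ D) (hb : HasBoxBound g s D)
    (hdisj : ∀ i j, i ≠ j → Disjoint (X i) (X j)) :
    |boxDensity g X - boxDensity g fun i => Q.innerUnion (X i)| ≤ 3 * r * D * δ :=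
  _root_.abs_boxDensity_sub_le hg hD hb hδ hdisj (fun _ => innerUnion_subset _)
    (fun i => (h i).1) (fun i => (h i).2.1) fun i => (h i).2.2

/-- The constant 7 is 6 + 1: the change `3 * r * D * δ` in density, times `2 * D`, for the
difference of squares, and `r * δ * D ^ 2` for the lost volume. -/
theorem Approximates.boxCard_mul_sq_ge (h : Q.Approximates δ s A) (hδ0 : 0 ≤ δ) (hδ : δ ≤ 1 / 2)
    (hg : ∀ x, 0 ≤ g x) (hD : 0 ≤ D) (hb : HasBoxBound g s D)
    (hdisj : ∀ i j, i ≠ j → Disjoint (A i) (A j)) :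
    boxCard A * (boxDensity g A ^ 2 - 7 * r * D ^ 2 * δ) ≤
      boxCard (fun i => Q.innerUnion (A i)) * boxDensity g (fun i => Q.innerUnion (A i)) ^ 2 := by
  have hdiff := h.abs_boxDensity_sub_le hδ hg hD hb hdisj
  have hcard := boxCard_ge_of_card_sdiff_le (by linarith) (fun i => innerUnion_subset (A i))
    (fun i => (h i).1)
  have hdA : boxDensity g A ≤ D := hb A hdisj fun i =>
    (h.le_half_card hδ i).trans (by linarith [Nat.cast_nonneg (α := ℝ) #(A i)])
  have hdU : boxDensity g (fun i => Q.innerUnion (A i)) ≤ D :=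
    hb _ (fun i j hij => (hdisj i j hij).mono (innerUnion_subset _) (innerUnion_subset _))
      fun i => (h.le_half_card hδ i).trans (h.half_card_le hδ i)
  have h0A := boxDensity_nonneg hg A
  have h0U := boxDensity_nonneg hg fun i => Q.innerUnion (A i)
  have hW := boxCard_nonneg A
  generalize boxDensity g (fun i => Q.innerUnion (A i)) = u at *
  generalize boxDensity g A = a at *
  generalize boxCard (fun i => Q.innerUnion (A i)) = w at *
  have h1 : a ^ 2 - u ^ 2 ≤ 3 * r * D * δ * (2 * D) := by
    calc a ^ 2 - u ^ 2 = (a - u) * (a + u) := by ring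
      _ ≤ 3 * r * D * δ * (a + u) :=
        mul_le_mul_of_nonneg_right (abs_le.1 hdiff).2 (by linarith)
      _ ≤ _ := mul_le_mul_of_nonneg_left (by linarith) (by positivity)
  have h2 : r * δ * u ^ 2 ≤ r * δ * D ^ 2 :=
    mul_le_mul_of_nonneg_left (pow_le_pow_left₀ h0U hdU 2) (by positivity)
  calc boxCard A * (a ^ 2 - 7 * r * D ^ 2 * δ) ≤ boxCard A * ((1 - r * δ) * u ^ 2) :=
        mul_le_mul_of_nonneg_left (by linarith) hW
    _ = (1 - r * δ) * boxCard A * u ^ 2 := by ring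
    _ ≤ w * u ^ 2 := mul_le_mul_of_nonneg_right hcard (sq_nonneg u)

theorem Approximates.boxEnergy_in_ge (h : Q.Approximates δ s A) (hδ0 : 0 ≤ δ) (hδ : δ ≤ 1 / 2)
    (hg : ∀ x, 0 ≤ g x) (hD : 0 ≤ D) (hb : HasBoxBound g s D)
    (hdisj : ∀ i j, i ≠ j → Disjoint (A i) (A j)) :
    boxCard A * (boxDensity g A ^ 2 - 7 * r * D ^ 2 * δ) ≤
      ∑ B ∈ Q.tuplesIn A, boxCard B * boxDensity g B ^ 2 := by
  have h1 := Finpartition.boxEnergy_in_ge g (X := A) (fun i => Subset.rfl) (h.nonempty hδ)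
    (h.nonempty hδ)
  rw [sub_self] at h1
  have h2 := h.boxCard_mul_sq_ge hδ0 hδ hg hD hb hdisj
  linarith

theorem Approximates.boxEnergy_in_ge_of_irregular (h : Q.Approximates δ s A)
    (hX : Q.Approximates δ s X) (hδ0 : 0 ≤ δ) (hδ : δ ≤ 1 / 2)
    (hg : ∀ x, 0 ≤ g x) (hD : 0 ≤ D) (hb : HasBoxBound g s D)
    (hdisj : ∀ i j, i ≠ j → Disjoint (A i) (A j)) {ε : ℝ} (hε : 0 ≤ ε)
    (hδε : 6 * r * D * δ ≤ ε / 2) (hXA : ∀ i, X i ⊆ A i)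
    (hXc : ∀ i, ε * (#(A i) : ℝ) ≤ #(X i)) (hirr : ε < |boxDensity g X - boxDensity g A|) :
    boxCard A * (boxDensity g A ^ 2 - 7 * r * D ^ 2 * δ + (ε / 2) ^ r * (ε ^ 2 / 4)) ≤
      ∑ B ∈ Q.tuplesIn A, boxCard B * boxDensity g B ^ 2 := by
  have h1 := Finpartition.boxEnergy_in_ge g hXA (h.nonempty hδ) (hX.nonempty hδ)
  have h2 := h.boxCard_mul_sq_ge hδ0 hδ hg hD hb hdisj
  have hdA := h.abs_boxDensity_sub_le hδ hg hD hb hdisj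
  have hdX := hX.abs_boxDensity_sub_le hδ hg hD hb
    fun i j hij => (hdisj i j hij).mono (hXA i) (hXA j)
  -- Each side of the witness has relative size at least `ε`, and at least half of it survives the
  -- approximation.
  have hc : (ε / 2) ^ r * boxCard A ≤ boxCard fun i => Q.innerUnion (X i) := by
    have : (ε / 2) ^ r * boxCard A = ∏ i, (ε / 2 * (#(A i) : ℝ)) := by
      rw [prod_mul_distrib, prod_const, card_univ, Fintype.card_fin, boxCard]
    rw [this]
    refine prod_le_prod (fun i _ => by positivity) fun i _ => ?_
    linarith [hXc i, hX.half_card_le hδ i]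
  -- The two approximations use up at most `6 * r * D * δ ≤ ε / 2` of the deviation `ε`.
  have hsq : ε ^ 2 / 4 ≤ (boxDensity g (fun i => Q.innerUnion (X i)) -
      boxDensity g (fun i => Q.innerUnion (A i))) ^ 2 := by
    have : ε / 2 ≤ |boxDensity g (fun i => Q.innerUnion (X i)) -
        boxDensity g (fun i => Q.innerUnion (A i))| := by
      rw [abs_le] at hdA hdX
      rw [le_abs]
      rcases lt_abs.1 hirr with h | h
      · left; linarith
      · right; linarith
    rw [← sq_abs (_ - _)]
    calc ε ^ 2 / 4 = (ε / 2) ^ 2 := by ring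
      _ ≤ _ := pow_le_pow_left₀ (by linarith) this 2
  have h3 := mul_le_mul hc hsq (by positivity) (boxCard_nonneg _)
  linarith

open Classical in
/-- A partition with many irregular tuples for one of the functions `g j` has an approximate
refinement in which the energy of this `g j` is larger, and no other energy drops much. -/
theorem exists_energy_increment {κ : Type*} {g : κ → (Fin r → V) → ℝ} (hg : ∀ j x, 0 ≤ g j x)
    {ε ε₁ : ℝ} (hε : 0 < ε) (hε1 : ε ≤ 1) (hδ0 : 0 < δ) (hδ : δ ≤ 1 / 2) (hD : 0 ≤ D)
    (hδε : 6 * r * D * δ ≤ ε / 2) (hb : ∀ j, HasBoxBound (g j) s D) (hP : P.IsEquipartition)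
    {k M : ℕ} (hk : #P.parts = k) (hk0 : 0 < k) (hM : M ≤ Fintype.card V)
    (hkM : 2 * k * 2 ^ (k + k ^ r * r) ≤ δ * ε * M)
    (hs : s ≤ δ * ε * (Fintype.card V / (2 * k))) {j₀ : κ}
    (hirr : ε₁ * (k : ℝ) ^ r ≤ #{A ∈ P.tuples r | ¬ IsRegularBox (g j₀) ε A}) :
    ∃ Q : Finpartition (univ : Finset V), Q.IsEquipartition ∧ #Q.parts = M ∧
      (∀ j, boxEnergy (g j) P - 7 * r * D ^ 2 * δ * (Fintype.card V : ℝ) ^ r ≤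
        boxEnergy (g j) Q) ∧
      boxEnergy (g j₀) P + ((ε / 2) ^ r * (ε ^ 2 / 4) * (ε₁ / 2 ^ r) - 7 * r * D ^ 2 * δ) *
        (Fintype.card V : ℝ) ^ r ≤ boxEnergy (g j₀) Q := by
  set n := Fintype.card V
  have hwit : ∀ A : Fin r → Finset V, ∃ X : Fin r → Finset V, ¬ IsRegularBox (g j₀) ε A →
      (∀ i, X i ⊆ A i) ∧ (∀ i, ε * (#(A i) : ℝ) ≤ #(X i)) ∧
        ε < |boxDensity (g j₀) X - boxDensity (g j₀) A| := by
    intro A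
    by_cases h : IsRegularBox (g j₀) ε A
    · exact ⟨A, fun h' => absurd h h'⟩
    · have h' := h
      unfold IsRegularBox at h'
      push Not at h'
      obtain ⟨X, h1, h2, h3⟩ := h'
      exact ⟨X, fun _ => ⟨h1, h2, h3⟩⟩
  choose X hX using hwit
  -- The sets to approximate: the parts of `P` and the `r` sides of one chosen box for each of the
  -- `k ^ r` tuples. Hence the exponent `k + k ^ r * r`.
  set F : Finset (Finset V) := P.parts ∪
    ((Fintype.piFinset fun _ : Fin r => P.parts) ×ˢ (univ : Finset (Fin r))).image
      (fun a => X a.1 a.2) with hF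
  have hFc : #F ≤ k + k ^ r * r := by
    refine (card_union_le _ _).trans (add_le_add hk.le (card_image_le.trans ?_))
    simp [card_product, Fintype.card_piFinset, hk]
  have hδε0 : 0 < δ * ε := mul_pos hδ0 hε
  have hM0 : 0 < M := by
    rcases Nat.eq_zero_or_pos M with rfl | h
    · have : (0 : ℝ) < 2 * k * 2 ^ (k + k ^ r * r) := by positivity
      simp at hkM
      linarith
    · exact h
  have hkle : k ≤ n := by
    refine le_trans ?_ hM
    rw [← Nat.cast_le (α := ℝ)]
    have h1 : (k : ℝ) ≤ 2 * k * 2 ^ (k + k ^ r * r) := by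
      have : (1 : ℝ) ≤ 2 ^ (k + k ^ r * r) := one_le_pow₀ (by norm_num)
      have : (k : ℝ) * 1 ≤ k * 2 ^ (k + k ^ r * r) := mul_le_mul_of_nonneg_left this (by positivity)
      linarith [Nat.cast_nonneg (α := ℝ) k]
    have h2 : δ * ε * M ≤ 1 * M := mul_le_mul_of_nonneg_right
      (mul_le_one₀ (by linarith) hε.le hε1) (Nat.cast_nonneg _)
    linarith
  obtain ⟨Q, hQ, hQc, hQa⟩ := exists_isEquipartition_approx F hM0.ne' hM
  have hpart : ∀ u ∈ P.parts, (n : ℝ) / (2 * k) ≤ #u := fun u hu => by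
    have := hP.card_div_le (hk.le.trans hkle) hu
    rwa [hk] at this
  have hk0' : (0 : ℝ) < k := Nat.cast_pos.2 hk0
  have hdivM : 1 ≤ n / M := Nat.div_pos hM hM0
  have hrem : ((2 ^ #F * (n / M) : ℕ) : ℝ) ≤ δ * (ε * (n / (2 * k))) := by
    have h1 : ((2 ^ #F : ℕ) : ℝ) ≤ 2 ^ (k + k ^ r * r) := by
      exact_mod_cast Nat.pow_le_pow_right (by norm_num) hFc
    have h2 : ((n / M : ℕ) : ℝ) ≤ n / M := Nat.cast_div_le
    rw [Nat.cast_mul]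
    refine (mul_le_mul h1 h2 (Nat.cast_nonneg _) (by positivity)).trans ?_
    rw [mul_div_assoc', div_le_iff₀ (by positivity),
      show δ * (ε * ((n : ℝ) / (2 * k))) * M = (δ * ε * M) * n / (2 * k) by ring,
      le_div_iff₀ (by positivity)]
    calc _ = 2 * k * 2 ^ (k + k ^ r * r) * (n : ℝ) := by ring
      _ ≤ _ := mul_le_mul_of_nonneg_right hkM (Nat.cast_nonneg _)
  -- The quantity bounded in `hrem` is a positive integer.
  have hone : (1 : ℝ) ≤ δ * (ε * (n / (2 * k))) := by
    refine le_trans ?_ hrem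
    exact_mod_cast Nat.mul_pos (by positivity) hdivM
  have happ : ∀ Y : Fin r → Finset V, (∀ i, Y i ∈ F) → (∀ i, ε * ((n : ℝ) / (2 * k)) ≤ #(Y i)) →
      Q.Approximates δ s Y := by
    intro Y hY hYc i
    have h1 := mul_le_mul_of_nonneg_left (hYc i) hδ0.le
    exact ⟨(Nat.cast_le.2 (hQa _ (hY i))).trans (hrem.trans h1),
      hs.trans (by linarith), hone.trans h1⟩
  have happA : ∀ A ∈ P.tuples r, Q.Approximates δ s A := fun A hA => by
    refine happ A (fun i => mem_union_left _ ((mem_tuples.1 hA).1 i)) fun i => ?_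
    refine le_trans ?_ (hpart _ ((mem_tuples.1 hA).1 i))
    exact mul_le_of_le_one_left (by positivity) hε1
  have hloss : 0 ≤ 7 * r * D ^ 2 * δ := by positivity
  have hsumle := mul_le_mul_of_nonneg_left (sum_boxCard_tuples_le (P := P) (r := r)) hloss
  refine ⟨Q, hQ, hQc, fun j => ?_, ?_⟩
  · refine le_trans ?_ (sum_tuplesIn_le_boxEnergy (P := P) (g j))
    refine le_trans ?_ (sum_le_sum fun A hA => (happA A hA).boxEnergy_in_ge hδ0.le hδ (hg j) hD
      (hb j) (disjoint_of_mem_tuples hA))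
    simp_rw [mul_sub, sum_sub_distrib, ← sum_mul]
    simp only [boxEnergy]
    linarith
  · refine le_trans ?_ (sum_tuplesIn_le_boxEnergy (P := P) (g j₀))
    set c := (ε / 2) ^ r * (ε ^ 2 / 4) with hc
    have hlocal : ∀ A ∈ P.tuples r, boxCard A * (boxDensity (g j₀) A ^ 2 - 7 * r * D ^ 2 * δ) +
        (if ¬ IsRegularBox (g j₀) ε A then c * ((n : ℝ) / (2 * k)) ^ r else 0) ≤
        ∑ B ∈ Q.tuplesIn A, boxCard B * boxDensity (g j₀) B ^ 2 := by
      intro A hA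
      split_ifs with hAirr
      · rw [add_zero]
        exact (happA A hA).boxEnergy_in_ge hδ0.le hδ (hg j₀) hD
          (hb j₀) (disjoint_of_mem_tuples hA)
      · obtain ⟨h1, h2, h3⟩ := hX A hAirr
        have hXa : Q.Approximates δ s (X A) := by
          refine happ _ (fun i => mem_union_right _ (mem_image.2 ⟨(A, i), ?_, rfl⟩)) fun i =>
            (mul_le_mul_of_nonneg_left (hpart _ ((mem_tuples.1 hA).1 i)) hε.le).trans (h2 i)
          exact mem_product.2 ⟨Fintype.mem_piFinset.2 (mem_tuples.1 hA).1, mem_univ _⟩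
        refine le_trans ?_ ((happA A hA).boxEnergy_in_ge_of_irregular hXa hδ0.le hδ (hg j₀) hD
          (hb j₀) (disjoint_of_mem_tuples hA) hε.le hδε h1 h2 h3)
        rw [mul_add]
        refine add_le_add le_rfl ?_
        rw [mul_comm]
        refine mul_le_mul_of_nonneg_right ?_ (by positivity)
        rw [boxCard]
        refine le_trans (by simp [div_pow]) (prod_le_prod (s := univ)
          (f := fun _ : Fin r => (n : ℝ) / (2 * k)) (fun i _ => by positivity) fun i _ =>
            hpart _ ((mem_tuples.1 hA).1 i))
    refine le_trans ?_ (sum_le_sum hlocal)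
    rw [sum_add_distrib, ← sum_filter, sum_const, nsmul_eq_mul]
    -- The powers of `k` cancel, so the gain does not depend on the number of parts.
    have hgain : c * (ε₁ / 2 ^ r) * (n : ℝ) ^ r ≤
        #{A ∈ P.tuples r | ¬ IsRegularBox (g j₀) ε A} * (c * ((n : ℝ) / (2 * k)) ^ r) := by
      refine le_trans (le_of_eq ?_) (mul_le_mul_of_nonneg_right hirr (by positivity))
      rw [div_pow, mul_pow]
      field_simp
    simp_rw [mul_sub, sum_sub_distrib, ← sum_mul]
    simp only [boxEnergy]
    linarith

end Finpartition

end Increment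

/-! ### Regular partitions for families of functions -/

section Iteration

/-- The number of parts after one refinement step. -/
noncomputable def refinementBound (c : ℝ) (r k : ℕ) : ℕ :=
  ⌈2 * (k : ℝ) * 2 ^ (k + k ^ r * r) / c⌉₊

theorem le_refinementBound {c : ℝ} (hc : 0 < c) (hc1 : c ≤ 1) (r k : ℕ) :
    k ≤ refinementBound c r k := by
  rw [← Nat.cast_le (α := ℝ)]
  refine le_trans ?_ (Nat.le_ceil _)
  rw [le_div_iff₀ hc]
  have h1 : (1 : ℝ) ≤ 2 ^ (k + k ^ r * r) := one_le_pow₀ (by norm_num)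
  have h2 : (k : ℝ) * 1 ≤ k * 2 ^ (k + k ^ r * r) := mul_le_mul_of_nonneg_left h1 (by positivity)
  have h3 : (k : ℝ) * c ≤ k * 1 := mul_le_mul_of_nonneg_left hc1 (by positivity)
  linarith [Nat.cast_nonneg (α := ℝ) k]

theorem le_mul_refinementBound {c : ℝ} (hc : 0 < c) (r k : ℕ) :
    2 * (k : ℝ) * 2 ^ (k + k ^ r * r) ≤ c * refinementBound c r k := by
  rw [mul_comm c, ← div_le_iff₀ hc]
  exact Nat.le_ceil _

open Classical in
/-- The regularity lemma for families of functions on `V ^ r` with bounded densities. -/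
theorem exists_isEquipartition_regular {ε ε₁ D : ℝ} (hε : 0 < ε) (hε1 : ε ≤ 1) (hε₁ : 0 < ε₁)
    (hD : 0 < D) (q r : ℕ) {k₀ : ℕ} (hk₀ : 0 < k₀) :
    ∃ (K : ℕ) (η : ℝ), 0 < K ∧ 0 < η ∧ η ≤ ε / (2 * K) ∧
      ∀ (V : Type*) [Fintype V] [DecidableEq V], K ≤ Fintype.card V →
        ∀ g : Fin q → (Fin r → V) → ℝ, (∀ j x, 0 ≤ g j x) →
          (∀ j, HasBoxBound (g j) (η * Fintype.card V) D) →
            ∃ P : Finpartition (univ : Finset V), P.IsEquipartition ∧ k₀ ≤ #P.parts ∧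
              #P.parts ≤ K ∧ ∀ j,
                (#{A ∈ P.tuples r | ¬ IsRegularBox (g j) ε A} : ℝ) ≤ ε₁ * (#P.parts : ℝ) ^ r := by
  set c : ℝ := (ε / 2) ^ r * (ε ^ 2 / 4) * (ε₁ / 2 ^ r) with hc
  have hc0 : 0 < c := by positivity
  -- The last condition makes the losses of all `q` functions together at most half of one gain. In
  -- the witness, `r + 1` and `q + 1` avoid division by zero.
  obtain ⟨δ, hδ0, hδ, hδε, hδc⟩ : ∃ δ : ℝ, 0 < δ ∧ δ ≤ 1 / 2 ∧ 6 * r * D * δ ≤ ε / 2 ∧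
      q * (7 * r * D ^ 2 * δ) ≤ c / 2 := by
    refine ⟨min (1 / 2) (min (ε / 2 / (6 * (r + 1) * D)) (c / 2 / ((q + 1) * (7 * (r + 1) * D ^ 2)))),
      by positivity, min_le_left _ _, ?_, ?_⟩
    · refine le_trans (mul_le_mul_of_nonneg_left ((min_le_right _ _).trans (min_le_left _ _))
        (by positivity)) ?_
      rw [mul_div_assoc', div_le_iff₀ (by positivity), mul_comm]
      gcongr
      linarith
    · rw [← mul_assoc]
      refine le_trans (mul_le_mul_of_nonneg_left ((min_le_right _ _).trans (min_le_right _ _))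
        (by positivity)) ?_
      rw [mul_div_assoc', div_le_iff₀ (by positivity), mul_comm]
      gcongr <;> linarith
  have hδε0 : 0 < δ * ε := mul_pos hδ0 hε
  have hδε1 : δ * ε ≤ 1 := mul_le_one₀ (by linarith) hε.le hε1
  set f : ℕ → ℕ := fun i => (refinementBound (δ * ε) r)^[i] k₀ with hf
  have hfs : ∀ i, f (i + 1) = refinementBound (δ * ε) r (f i) := fun i =>
    Function.iterate_succ_apply' _ _ _
  have hmono : Monotone f := monotone_nat_of_le_succ fun i => by
    rw [hfs]
    exact le_refinementBound hδε0 hδε1 _ _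
  have hfk : ∀ i, k₀ ≤ f i := fun i => hmono (Nat.zero_le i)
  -- After this many gains of `c / 2` the total energy would exceed its upper bound `q * D ^ 2`, in
  -- units of `n ^ r`.
  obtain ⟨N, hN⟩ := exists_nat_gt (q * D ^ 2 / (c / 2))
  have hK0 : 0 < f N := hk₀.trans_le (hfk N)
  have hK0' : (0 : ℝ) < f N := Nat.cast_pos.2 hK0
  -- With this `η`, the box bound still applies to a `δ * ε` fraction of any part, at every stage up
  -- to `N`.
  refine ⟨f N, δ * ε / (2 * f N), hK0, by positivity, ?_, ?_⟩
  · gcongr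
    exact mul_le_of_le_one_left hε.le (by linarith)
  intro V _ _ hV g hg hb
  set n := Fintype.card V
  have hn0 : (0 : ℝ) < (n : ℝ) ^ r := pow_pos (Nat.cast_pos.2 (hK0.trans_le hV)) r
  have hs : ∀ i ≤ N, δ * ε / (2 * f N) * n ≤ δ * ε * ((n : ℝ) / (2 * f i)) := by
    intro i hi
    have h0 : (0 : ℝ) < f i := Nat.cast_pos.2 (hk₀.trans_le (hfk i))
    rw [div_mul_eq_mul_div, ← mul_div_assoc]
    have : (f i : ℝ) ≤ f N := Nat.cast_le.2 (hmono hi)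
    gcongr
  by_contra hcon
  push Not at hcon
  have hstep : ∀ i ≤ N, ∃ P : Finpartition (univ : Finset V), P.IsEquipartition ∧
      #P.parts = f i ∧ i * (c / 2) * (n : ℝ) ^ r ≤ ∑ j, boxEnergy (g j) P := by
    intro i
    induction i with
    | zero =>
      intro _
      obtain ⟨P, hP, hPc⟩ := Finpartition.exists_equipartition_card_eq (univ : Finset V)
        hk₀.ne' ((hfk N).trans (hV.trans_eq card_univ.symm))
      refine ⟨P, hP, hPc, ?_⟩
      simp only [Nat.cast_zero, zero_mul]
      exact sum_nonneg fun j _ => sum_nonneg fun A _ =>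
        mul_nonneg (boxCard_nonneg A) (sq_nonneg _)
    | succ i ih =>
      intro hi
      obtain ⟨P, hP, hPc, hPE⟩ := ih (by omega)
      obtain ⟨j₀, hj₀⟩ := hcon P hP (hPc ▸ hfk i) (hPc ▸ hmono (by omega))
      rw [hPc] at hj₀
      obtain ⟨Q, hQ, hQc, hQE, hQE₀⟩ := Finpartition.exists_energy_increment hg hε hε1 hδ0 hδ hD.le
        hδε hb hP hPc (hk₀.trans_le (hfk i)) ((hfs i ▸ hmono hi).trans hV)
        (le_mul_refinementBound hδε0 r (f i)) (hs i (by omega)) hj₀.le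
      refine ⟨Q, hQ, hQc.trans (hfs i).symm, ?_⟩
      have hsum : ∑ j, (boxEnergy (g j) P - 7 * r * D ^ 2 * δ * (n : ℝ) ^ r +
          if j = j₀ then c * (n : ℝ) ^ r else 0) ≤ ∑ j, boxEnergy (g j) Q := by
        refine sum_le_sum fun j _ => ?_
        split_ifs with h
        · subst h
          refine le_trans (le_of_eq ?_) hQE₀
          rw [← hc]
          simp only [n]
          ring
        · rw [add_zero]
          exact hQE j
      rw [sum_add_distrib, sum_sub_distrib, sum_ite_eq' univ j₀, if_pos (mem_univ _), sum_const,
        card_univ, Fintype.card_fin, nsmul_eq_mul] at hsum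
      have := mul_le_mul_of_nonneg_right hδc hn0.le
      push_cast
      linarith
  obtain ⟨P, hP, hPc, hPE⟩ := hstep N le_rfl
  have hup : ∑ j, boxEnergy (g j) P ≤ q * (D ^ 2 * (n : ℝ) ^ r) := by
    refine (sum_le_sum fun j _ => Finpartition.boxEnergy_le (hg j) (hb j) fun u hu => ?_).trans_eq
      (by simp [n])
    have h1 := hP.card_div_le (hPc.le.trans hV) hu
    rw [hPc] at h1
    refine le_trans (hs N le_rfl) (le_trans ?_ h1)
    exact mul_le_of_le_one_left (by positivity) hδε1
  rw [div_lt_iff₀ (by positivity)] at hN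
  have := mul_lt_mul_of_pos_right hN hn0
  linarith

end Iteration

/-! ### Application to hypergraphs -/

namespace RGraph

section

variable {V : Type*} [DecidableEq V] {r : ℕ}

theorem mem_crossingEdges {ι : Type*} [Fintype ι] {H : RGraph V r} {X : ι → Finset V}
    {e : Finset V} : e ∈ H.crossingEdges X ↔ e ∈ H.edges ∧ ∀ i, #(e ∩ X i) = 1 :=
  mem_filter

/-- Lets families indexed by a set of parts be exchanged for tuples indexed by `Fin r`. -/
theorem density_comp_equiv {ι κ : Type*} [Fintype ι] [Fintype κ] (H : RGraph V r) (e : κ ≃ ι)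
    (X : ι → Finset V) : H.density (X ∘ e) = H.density X := by
  have h1 : H.crossingEdges (X ∘ e) = H.crossingEdges X := by
    unfold crossingEdges
    refine filter_congr fun a _ => ?_
    exact e.forall_congr_left.trans (by simp)
  unfold density
  rw [h1, ← e.prod_comp]
  rfl

theorem isRegularTuple_of_comp_equiv {ι κ : Type*} [Fintype ι] [Fintype κ] {H : RGraph V r}
    {ε p : ℝ} (e : κ ≃ ι) {W : ι → Finset V} (h : H.IsRegularTuple ε p (W ∘ e)) :
    H.IsRegularTuple ε p W := fun X hX hXc => by
  have := h (X ∘ e) (fun i => hX _) fun i => hXc _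
  rwa [density_comp_equiv, density_comp_equiv] at this

theorem IsRegularTuple.mono {ι : Type*} [Fintype ι] {H : RGraph V r} {ε ε' p : ℝ} (hε : ε ≤ ε')
    (hp : 0 ≤ p) {W : ι → Finset V} (h : H.IsRegularTuple ε p W) :
    H.IsRegularTuple ε' p W := fun X hX hXc =>
  (h X hX fun i => (mul_le_mul_of_nonneg_right hε (Nat.cast_nonneg _)).trans (hXc i)).trans
    (mul_le_mul_of_nonneg_right hε hp)

/-- The indicator function of the edges of `H`, normalised by `p`. -/
noncomputable def edgeFun (H : RGraph V r) (p : ℝ) (x : Fin r → V) : ℝ :=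
  (if univ.image x ∈ H.edges then 1 else 0) / p

theorem edgeFun_nonneg (H : RGraph V r) {p : ℝ} (hp : 0 ≤ p) (x : Fin r → V) :
    0 ≤ H.edgeFun p x := by
  unfold edgeFun
  split_ifs <;> positivity

theorem image_inter_eq_singleton {X : Fin r → Finset V}
    (hX : ∀ i j, i ≠ j → Disjoint (X i) (X j)) {x : Fin r → V} (hx : ∀ i, x i ∈ X i)
    (i : Fin r) : univ.image x ∩ X i = {x i} := by
  ext v
  simp only [mem_inter, mem_image, mem_univ, true_and, mem_singleton]
  constructor
  · rintro ⟨⟨j, rfl⟩, hj⟩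
    by_contra hne
    exact disjoint_left.1 (hX j i fun h => hne (h ▸ rfl)) (hx j) hj
  · rintro rfl
    exact ⟨⟨i, rfl⟩, hx i⟩

/-- A crossing edge has exactly `r` vertices, so its single vertices in the `r` disjoint sides
exhaust it and determine a unique point of the box. -/
theorem card_crossingEdges (H : RGraph V r) {X : Fin r → Finset V}
    (hX : ∀ i j, i ≠ j → Disjoint (X i) (X j)) :
    #(H.crossingEdges X) = #{x ∈ Fintype.piFinset X | univ.image x ∈ H.edges} := by
  symm
  refine card_bij (fun x _ => univ.image x) ?_ ?_ ?_
  · intro x hx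
    rw [mem_filter, Fintype.mem_piFinset] at hx
    refine mem_crossingEdges.2 ⟨hx.2, fun i => ?_⟩
    rw [image_inter_eq_singleton hX hx.1, card_singleton]
  · intro x hx y hy hxy
    rw [mem_filter, Fintype.mem_piFinset] at hx hy
    funext i
    have h := image_inter_eq_singleton hX hx.1 i
    rw [hxy, image_inter_eq_singleton hX hy.1 i] at h
    exact (singleton_injective h).symm
  · intro e he
    obtain ⟨he, hei⟩ := mem_crossingEdges.1 he
    choose x hx using fun i => card_eq_one.1 (hei i)
    have hx' : ∀ i, x i ∈ e ∩ X i := fun i => by rw [hx i]; exact mem_singleton_self _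
    have hxX : ∀ i, x i ∈ X i := fun i => (mem_inter.1 (hx' i)).2
    have hinj : Function.Injective x := fun i j hij => by
      by_contra hne
      exact disjoint_left.1 (hX i j hne) (hxX i) (hij ▸ hxX j)
    have himg : univ.image x = e := by
      refine eq_of_subset_of_card_le ?_ ?_
      · intro v hv
        obtain ⟨i, -, rfl⟩ := mem_image.1 hv
        exact (mem_inter.1 (hx' i)).1
      · rw [card_image_of_injective _ hinj, H.card_eq e he, card_univ, Fintype.card_fin]
    exact ⟨x, mem_filter.2 ⟨Fintype.mem_piFinset.2 hxX, himg ▸ he⟩, himg⟩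

theorem boxDensity_edgeFun (H : RGraph V r) (p : ℝ) {X : Fin r → Finset V}
    (hX : ∀ i j, i ≠ j → Disjoint (X i) (X j)) :
    boxDensity (H.edgeFun p) X = H.density X / p := by
  unfold boxDensity boxSum edgeFun density
  rw [card_crossingEdges H hX, ← sum_div, sum_boole, boxCard, div_right_comm]

theorem density_nonneg (H : RGraph V r) {ι : Type*} [Fintype ι] (X : ι → Finset V) :
    0 ≤ H.density X :=
  div_nonneg (Nat.cast_nonneg _) (prod_nonneg fun _ _ => Nat.cast_nonneg _)

theorem isRegularTuple_of_isRegularBox {H : RGraph V r} {ε p : ℝ} (hp : 0 < p)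
    {A : Fin r → Finset V} (hA : ∀ i j, i ≠ j → Disjoint (A i) (A j))
    (h : IsRegularBox (H.edgeFun p) ε A) : H.IsRegularTuple ε p A := fun X hX hXc => by
  have := h X hX hXc
  rwa [boxDensity_edgeFun H p hA,
    boxDensity_edgeFun H p fun i j hij => (hA i j hij).mono (hX i) (hX j), ← sub_div, abs_div,
    abs_of_pos hp, div_le_iff₀ hp] at this

end

variable {V : Type*} [Fintype V] [DecidableEq V] {r : ℕ}

theorem IsUpperUniform.hasBoxBound {H : RGraph V r} {η η' p D : ℝ} (h : H.IsUpperUniform η p D)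
    (hη : η ≤ η') (hp : 0 < p) : HasBoxBound (H.edgeFun p) (η' * Fintype.card V) D :=
  fun X hX hXc => by
    rw [boxDensity_edgeFun H p hX, div_le_iff₀ hp]
    exact h X hX fun i => (mul_le_mul_of_nonneg_right hη (Nat.cast_nonneg _)).trans (hXc i)

/-- The tolerance is 0 here, but all boxes concerned are large enough for upper-uniformity to force
density 0. -/
theorem isRegularTuple_of_isUpperUniform_zero {H : RGraph V r} {ε η D : ℝ}
    (h : H.IsUpperUniform η 0 D) (hε1 : ε ≤ 1) {A : Fin r → Finset V}
    (hA : ∀ i j, i ≠ j → Disjoint (A i) (A j))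
    (hAc : ∀ i, η * Fintype.card V ≤ ε * (#(A i) : ℝ)) : H.IsRegularTuple ε 0 A :=
  fun X hX hXc => by
    have h0 : ∀ Y : Fin r → Finset V, (∀ i, Y i ⊆ A i) →
        (∀ i, ε * (#(A i) : ℝ) ≤ #(Y i)) → H.density Y = 0 := fun Y hY hYc =>
      le_antisymm ((h Y (fun i j hij => (hA i j hij).mono (hY i) (hY j))
        fun i => (hAc i).trans (hYc i)).trans_eq (mul_zero D)) (H.density_nonneg Y)
    rw [h0 X hX hXc, h0 A (fun _ => Subset.rfl) fun i =>
      mul_le_of_le_one_left (Nat.cast_nonneg _) hε1]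
    simp

open Classical in
/-- Each irregular `r`-set of parts can be ordered into an irregular tuple of parts. -/
theorem card_irregularSets_le (H : RGraph V r) (ε p : ℝ) (P : Finpartition (univ : Finset V)) :
    #(H.irregularSets ε p P) ≤ #{A ∈ P.tuples r | ¬ H.IsRegularTuple ε p A} := by
  refine card_le_card_of_surjOn (fun A => univ.image A) ?_
  intro 𝒜 h𝒜
  obtain ⟨h1, hirr⟩ := mem_filter.1 (mem_coe.1 h𝒜)
  obtain ⟨hsub, hcard⟩ := mem_powersetCard.1 h1
  let e : Fin r ≃ 𝒜 := (𝒜.equivFinOfCardEq hcard).symm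
  refine ⟨fun i => (e i : Finset V), ?_, ?_⟩
  · refine mem_coe.2 (mem_filter.2 ⟨Finpartition.mem_tuples.2 ⟨fun i => hsub (e i).2, ?_⟩, ?_⟩)
    · exact Subtype.val_injective.comp e.injective
    · exact fun h => hirr (isRegularTuple_of_comp_equiv e h)
  · ext u
    simp only [mem_image, mem_univ, true_and]
    constructor
    · rintro ⟨i, rfl⟩
      exact (e i).2
    · intro hu
      exact ⟨e.symm ⟨u, hu⟩, by simp⟩

open Classical in
theorem irregularSets_card_le_of_le (H : RGraph V r) {ε ε' p : ℝ} (hε : ε ≤ ε') (hp : 0 ≤ p)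
    (P : Finpartition (univ : Finset V)) :
    #(H.irregularSets ε' p P) ≤ #(H.irregularSets ε p P) :=
  card_le_card (monotone_filter_right _ fun _ _ h h' => h (h'.mono hε hp))

/-- Since `ε > 0`, an admissible subset of a singleton is non-empty, hence the singleton itself:
there is no proper sub-box to test. -/
theorem irregularSets_bot (H : RGraph V r) {ε p : ℝ} (hε : 0 < ε) (hp : 0 ≤ p) :
    H.irregularSets ε p ⊥ = ∅ := by
  classical
  unfold irregularSets
  refine filter_eq_empty_iff.2 fun 𝒜 h𝒜 => not_not.2 fun X hX hXc => ?_
  have : X = fun A : 𝒜 => (A : Finset V) := by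
    funext A
    obtain ⟨a, -, ha⟩ := Finpartition.mem_bot_iff.1 ((mem_powersetCard.1 h𝒜).1 A.2)
    have h1 : ε * (#(A : Finset V) : ℝ) ≤ #(X A) := hXc A
    have h2 : X A ⊆ A := hX A
    rw [← ha] at h1 h2 ⊢
    rcases subset_singleton_iff.1 h2 with h | h
    · rw [h] at h1
      simp at h1
      linarith
    · exact h
  rw [this, sub_self, abs_zero]
  positivity

end RGraph

/-- Each of the `r` factors of the falling factorial is at least `t + 1 - r ≥ t / 2`. -/
theorem pow_le_mul_choose {r t : ℕ} (h : 2 * r ≤ t) :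
    (t : ℝ) ^ r ≤ 2 ^ r * r.factorial * t.choose r := by
  have h1 := Nat.pow_le_choose (α := ℝ) r t
  rw [div_le_iff₀ (by positivity)] at h1
  have h2 : (t : ℝ) ≤ 2 * ((t + 1 - r : ℕ) : ℝ) := by
    exact_mod_cast (by omega : t ≤ 2 * (t + 1 - r))
  calc (t : ℝ) ^ r ≤ (2 * ((t + 1 - r : ℕ) : ℝ)) ^ r := pow_le_pow_left₀ (by positivity) h2 r
    _ = 2 ^ r * ((t + 1 - r : ℕ) : ℝ) ^ r := mul_pow _ _ _
    _ ≤ 2 ^ r * (t.choose r * r.factorial) := mul_le_mul_of_nonneg_left h1 (by positivity)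
    _ = _ := by ring

theorem lemma3p1 (ε D : ℝ) (q r t₀ : ℕ) (hε : 0 < ε) (hD : 1 < D)
    (hq : 1 ≤ q) (hr : 1 ≤ r) (ht₀ : 1 ≤ t₀) :
    ∃ (T₀ : ℕ) (η₀ : ℝ), 0 < η₀ ∧
      ∀ T : ℕ, T₀ ≤ T → ∀ η : ℝ, 0 < η → η ≤ η₀ →
        ∀ p : ℝ, 0 ≤ p → p ≤ 1 →
          ∀ (V : Type*) [Fintype V] [DecidableEq V], t₀ ≤ Fintype.card V →
            ∀ H : Fin q → RGraph V r, (∀ j, (H j).IsUpperUniform η p D) →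
              ∃ P : Finpartition (Finset.univ : Finset V),
                t₀ ≤ P.parts.card ∧ P.parts.card ≤ T ∧
                  ∀ j, (H j).IsRegularPartition ε p P := by
  classical
  have hε'0 : 0 < min ε 1 := lt_min hε one_pos
  -- The choice of `ε₁` pays for passing from `t ^ r` ordered tuples to `t.choose r` sets, which
  -- needs `2 * r ≤ t`; hence `k₀`. Regularity for `min ε 1` implies it for `ε`.
  obtain ⟨K, η₀, hK, hη₀, hη₀K, hmain⟩ := exists_isEquipartition_regular hε'0 (min_le_right _ _)
    (ε₁ := ε / (2 ^ r * r.factorial)) (by positivity) (one_pos.trans hD) q r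
    (k₀ := max t₀ (2 * r)) (lt_max_of_lt_left ht₀)
  refine ⟨K, η₀, hη₀, fun T hT η hη hηη₀ p hp _ V _ _ hV H hH => ?_⟩
  rcases le_total (Fintype.card V) K with hVK | hVK
  · refine ⟨⊥, ?_, ?_, fun j => ⟨Finpartition.bot_isEquipartition _, ?_⟩⟩
    · rwa [Finpartition.card_bot, card_univ]
    · rw [Finpartition.card_bot, card_univ]
      exact hVK.trans hT
    · rw [RGraph.irregularSets_bot _ hε hp, card_empty, Nat.cast_zero]
      positivity
  · -- for `p = 0` the functions `edgeFun` vanish, and every tuple of parts is regular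
    have hbound : ∀ j, HasBoxBound ((H j).edgeFun p) (η₀ * Fintype.card V) D := fun j => by
      rcases hp.eq_or_lt with rfl | hp0
      · intro X hX _
        rw [RGraph.boxDensity_edgeFun _ _ hX, div_zero]
        linarith
      · exact (hH j).hasBoxBound hηη₀ hp0
    obtain ⟨P, hP, hPk, hPK, hPirr⟩ := hmain V hVK (fun j => (H j).edgeFun p)
      (fun j => (H j).edgeFun_nonneg hp) hbound
    refine ⟨P, (le_max_left _ _).trans hPk, hPK.trans hT, fun j => ⟨hP, ?_⟩⟩
    have hsub : #{A ∈ P.tuples r | ¬ (H j).IsRegularTuple (min ε 1) p A} ≤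
        #{A ∈ P.tuples r | ¬ IsRegularBox ((H j).edgeFun p) (min ε 1) A} := by
      refine card_le_card fun A hA => ?_
      obtain ⟨hAP, hAirr⟩ := mem_filter.1 hA
      have hdisj := Finpartition.disjoint_of_mem_tuples hAP
      refine mem_filter.2 ⟨hAP, fun h => hAirr ?_⟩
      rcases hp.eq_or_lt with rfl | hp0
      · refine RGraph.isRegularTuple_of_isUpperUniform_zero (hH j) (min_le_right _ _) hdisj
          fun i => ?_
        have hi := (Finpartition.mem_tuples.1 hAP).1 i
        have hk0 : (0 : ℝ) < #P.parts := Nat.cast_pos.2 (card_pos.2 ⟨_, hi⟩)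
        calc η * (Fintype.card V : ℝ) ≤ min ε 1 / (2 * K) * Fintype.card V :=
              mul_le_mul_of_nonneg_right (hηη₀.trans hη₀K) (Nat.cast_nonneg _)
          _ = min ε 1 * (Fintype.card V / (2 * K)) := by ring
          _ ≤ min ε 1 * (Fintype.card V / (2 * #P.parts)) := by gcongr
          _ ≤ min ε 1 * #(A i) :=
              mul_le_mul_of_nonneg_left (hP.card_div_le (hPK.trans hVK) hi) hε'0.le
      · exact RGraph.isRegularTuple_of_isRegularBox hp0 hdisj h
    have h1 := ((H j).irregularSets_card_le_of_le (min_le_left ε 1) hp P).trans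
      (((H j).card_irregularSets_le _ p P).trans hsub)
    calc (#((H j).irregularSets ε p P) : ℝ) ≤ _ := Nat.cast_le.2 h1
      _ ≤ ε / (2 ^ r * r.factorial) * (#P.parts : ℝ) ^ r := hPirr j
      _ ≤ ε / (2 ^ r * r.factorial) * (2 ^ r * r.factorial * (#P.parts).choose r) :=
          mul_le_mul_of_nonneg_left (pow_le_mul_choose ((le_max_right _ _).trans hPk))
            (by positivity)
      _ = ε * (#P.parts).choose r := by field_simp
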